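/- All graphs are finite and simple, and $\mathbb{N}=\{1,2,3,\ldots\}$. For a graph $G$ and $n\in\mathbb{N}$, the $n$-subdivision $G^{\frac1n}$ is the graph obtained from $G$ by replacing every edge with a path of length $n$. For a graph $H$ and $m\in\mathbb{N}$, the $m$-th power $H^m$ is the graph on $V(H)$ in which two distinct vertices are adjacent if and only if their distance in $H$ is at most $m$. For $m,n\in\mathbb{N}$ the fractional power is $G^{\frac mn}:=(G^{\frac1n})^m$ (it depends on the pair $(m,n)$ and not only on the quotient $m/n$). Let $\chi$, $\omega$ and $\Delta$ denote the chromatic number, the clique number and the maximum degree. **Corollary 2.** Let $G$ be a connected graph with $\Delta(G)\ge 3$ and let $k,m\in\mathbb{N}$. Then $$\chi\bigl(G^{\frac{m}{k(m+1)}}\bigr)=\omega\bigl(G^{\frac{m}{k(m+1)}}\bigr).$$ -/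

import Mathlib

namespace SimpleGraph

/-- The vertices of the `n`-subdivision of `G`: the terminal vertices (the vertices of `G`) and,
for every edge `e` of `G`, the internal vertices `(e, l)` with `0 < l < n`. -/
abbrev SubdivVertex {V : Type*} (G : SimpleGraph V) (n : ℕ) : Type _ :=
  V ⊕ (G.edgeSet × Set.Ioo 0 n)

/-- The `l`-th vertex of the path of length `n` that replaces the edge `e`, for `0 ≤ l ≤ n`.
The path runs between the two ends of `e`; which end comes first is an arbitrary choice
(`Quot.out` picks an ordered pair that represents the unordered pair `e`). -/
noncomputable def hyperedge {V : Type*} (G : SimpleGraph V) (n : ℕ) (e : G.edgeSet) (l : ℕ) :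
    G.SubdivVertex n :=
  if h : l ∈ Set.Ioo 0 n then Sum.inr (e, ⟨l, h⟩)
  else if l = 0 then Sum.inl (Quot.out e.1).1
  else Sum.inl (Quot.out e.1).2

theorem hyperedge_ne_succ {V : Type*} (G : SimpleGraph V) (n : ℕ) (e : G.edgeSet) (l : ℕ)
    (hl : l < n) : G.hyperedge n e l ≠ G.hyperedge n e (l + 1) := by
  have hne : (Quot.out e.1).1 ≠ (Quot.out e.1).2 := by
    have h : G.Adj (Quot.out e.1).1 (Quot.out e.1).2 := by
      have he : s((Quot.out e.1).1, (Quot.out e.1).2) = e.1 := Quot.out_eq e.1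
      rw [← G.mem_edgeSet, he]
      exact e.2
    exact h.ne
  unfold hyperedge
  split_ifs <;> simp_all

/-- The `n`-subdivision of `G`, for `n ≥ 1`: every edge is replaced by a path of length `n`. -/
def subdivision {V : Type*} (G : SimpleGraph V) (n : ℕ) : SimpleGraph (G.SubdivVertex n) where
  Adj x y := ∃ (e : G.edgeSet) (l : ℕ), l < n ∧
    ((x = G.hyperedge n e l ∧ y = G.hyperedge n e (l + 1)) ∨
      (y = G.hyperedge n e l ∧ x = G.hyperedge n e (l + 1)))
  symm := ⟨by
    rintro x y ⟨e, l, hl, h⟩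
    exact ⟨e, l, hl, h.symm⟩⟩
  loopless := ⟨by
    rintro x ⟨e, l, hl, ⟨h₁, h₂⟩ | ⟨h₁, h₂⟩⟩ <;>
      exact G.hyperedge_ne_succ n e l hl (h₁.symm.trans h₂)⟩

/-- The `m`-th power of `G`: distinct vertices are adjacent when their distance is at most `m`
(`edist` is infinite between different components). -/
def power {V : Type*} (G : SimpleGraph V) (m : ℕ) : SimpleGraph V where
  Adj x y := x ≠ y ∧ G.edist x y ≤ m
  symm := ⟨fun x y h => ⟨h.1.symm, by rw [edist_comm]; exact h.2⟩⟩
  loopless := ⟨fun _ h => h.1 rfl⟩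

/-- The fractional power `G^(m/n)`: the `m`-th power of the `n`-subdivision of `G`. It depends on
the pair `(m, n)` and not only on the quotient. -/
def fractionalPower {V : Type*} (G : SimpleGraph V) (m n : ℕ) :
    SimpleGraph (G.SubdivVertex n) :=
  (G.subdivision n).power m

end SimpleGraph

/-! Put `M = m + 1` and `D = Δ(G)`. Both invariants equal `(m / 2) * D + 1 + m % 2`.

Lower bound: around a vertex of maximum degree, the ball of radius `m / 2` in the subdivision has
`(m / 2) * D + 1` vertices at pairwise distance at most `m`. For odd `m` one vertex at distance `(m
+ 1) / 2` can be added.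

Upper bound: half-edges are the edges of the bipartite incidence graph between vertices and edges of
`G`, whose degrees are at most `D` and `2`. König's theorem therefore colours them with `D` colours
(`exists_dart_coloring`). Since `M ∣ n`, each subdivided edge splits into blocks of length `M`. A
vertex is coloured by its distance to the nearest block end, together with the colour of the
half-edge pointing from that end into the block; block ends and block midpoints need no half-edge
colour. As `m < n`, two vertices at distance at most `m` lie on one edge or on two edges with a
common end (`eq_or_dartPoint_of_walk`), and the two conditions on the half-edge colouring separate
them in these two cases. -/

/-! ### König's edge colouring theorem -/

open Finset in
/-- A regular bipartite multigraph (edges `S`, ends given by `f` and `g`) decomposes into `k`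
perfect matchings. -/
theorem exists_edgeColoring_of_regular {I T : Type*} [Fintype T] [DecidableEq T] [DecidableEq I]
    (f g : I → T) (k : ℕ) : ∀ S : Finset I, (∀ t, #{i ∈ S | f i = t} = k) →
    (∀ t, #{i ∈ S | g i = t} = k) →
    ∃ c : I → ℕ, (∀ i ∈ S, c i < k) ∧
      ∀ i ∈ S, ∀ j ∈ S, i ≠ j → (f i = f j ∨ g i = g j) → c i ≠ c j := by
  induction k with
  | zero =>
    intro S hf _
    have hS : ∀ i, i ∉ S := fun i hi => by
      have := hf (f i)
      rw [card_eq_zero, filter_eq_empty_iff] at this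
      exact this hi rfl
    exact ⟨fun _ => 0, fun i hi => absurd hi (hS i), fun i hi => absurd hi (hS i)⟩
  | succ k ih =>
    intro S hf hg
    -- Hall's condition by double counting: the `#X * (k + 1)` edges leaving `X` all end in `N`,
    -- which receives only `#N * (k + 1)`. The resulting perfect matching `μ` gets the new colour
    -- `k`.
    obtain ⟨φ, hφ, hφmem⟩ := (all_card_le_biUnion_card_iff_exists_injective
      (fun a => ({i ∈ S | f i = a}).image g)).1 (by
        intro X
        set N := X.biUnion fun a => ({i ∈ S | f i = a}).image g with hN
        have h1 : #{i ∈ S | f i ∈ X} = #X * (k + 1) := by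
          rw [card_eq_sum_card_fiberwise (f := f) (t := X) (fun i hi => by
            have hi' := (mem_filter.1 (mem_coe.1 hi)).2
            exact hi')]
          rw [← smul_eq_mul, ← sum_const]
          refine sum_congr rfl fun a ha => ?_
          rw [← hf a, filter_filter]
          congr 1
          ext i
          simp only [mem_filter]
          constructor
          · rintro ⟨h1, h2, h3⟩
            exact ⟨h1, h3⟩
          · rintro ⟨h1, h3⟩
            exact ⟨h1, h3 ▸ ha, h3⟩
        have h2 : #{i ∈ S | g i ∈ N} = #N * (k + 1) := by
          rw [card_eq_sum_card_fiberwise (f := g) (t := N) (fun i hi => by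
            have hi' := (mem_filter.1 (mem_coe.1 hi)).2
            exact hi')]
          rw [← smul_eq_mul, ← sum_const]
          refine sum_congr rfl fun a ha => ?_
          rw [← hg a, filter_filter]
          congr 1
          ext i
          simp only [mem_filter]
          constructor
          · rintro ⟨h1, h2, h3⟩
            exact ⟨h1, h3⟩
          · rintro ⟨h1, h3⟩
            exact ⟨h1, h3 ▸ ha, h3⟩
        have h3 : #{i ∈ S | f i ∈ X} ≤ #{i ∈ S | g i ∈ N} := by
          refine card_le_card fun i hi => ?_
          rw [mem_filter] at hi ⊢
          refine ⟨hi.1, ?_⟩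
          rw [hN, mem_biUnion]
          exact ⟨f i, hi.2, mem_image_of_mem g (mem_filter.2 ⟨hi.1, rfl⟩)⟩
        rw [h1, h2] at h3
        exact Nat.le_of_mul_le_mul_right h3 k.succ_pos)
    have hch : ∀ a, ∃ i, i ∈ S ∧ f i = a ∧ g i = φ a := fun a => by
      obtain ⟨i, hi, h⟩ := mem_image.1 (hφmem a)
      exact ⟨i, (mem_filter.1 hi).1, (mem_filter.1 hi).2, h⟩
    choose μ hμS hμf hμg using hch
    have hsurj : Function.Surjective φ := Finite.surjective_of_injective hφ
    have hM : ∀ i, i ∈ univ.image μ ↔ i = μ (f i) := fun i => by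
      simp only [mem_image, mem_univ, true_and]
      constructor
      · rintro ⟨a, rfl⟩
        rw [hμf]
      · exact fun h => ⟨f i, h.symm⟩
    -- The matching meets the fibre over `t` in the single edge `μ a`, so its removal lowers each
    -- degree by exactly one.
    have herase : ∀ (h : I → T) (t : T) (a : T), (∀ b, h (μ b) = t ↔ b = a) →
        #{i ∈ S | h i = t} = k + 1 → #{i ∈ S \ univ.image μ | h i = t} = k := by
      intro h t a hb hc
      have : {i ∈ S \ univ.image μ | h i = t} = ({i ∈ S | h i = t}).erase (μ a) := by
        ext i
        simp only [mem_filter, mem_sdiff, mem_erase, mem_image, mem_univ, true_and]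
        constructor
        · rintro ⟨⟨h1, h2⟩, h3⟩
          exact ⟨fun h4 => h2 ⟨a, h4.symm⟩, h1, h3⟩
        · rintro ⟨h1, h2, h3⟩
          refine ⟨⟨h2, ?_⟩, h3⟩
          rintro ⟨b, rfl⟩
          exact h1 (by rw [(hb b).1 h3])
      rw [this, card_erase_of_mem (mem_filter.2 ⟨hμS a, (hb a).2 rfl⟩), hc, Nat.add_sub_cancel]
    obtain ⟨c, hc, hcc⟩ := ih (S \ univ.image μ)
      (fun t => herase f t t (fun b => by rw [hμf]) (hf t))
      (fun t => by
        obtain ⟨a, rfl⟩ := hsurj t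
        exact herase g (φ a) a (fun b => by rw [hμg, hφ.eq_iff]) (hg _))
    refine ⟨fun i => if i = μ (f i) then k else c i, fun i hi => ?_, fun i hi j hj hij hfg => ?_⟩
    · dsimp only
      split_ifs with h
      · exact k.lt_succ_self
      · exact (hc i (mem_sdiff.2 ⟨hi, by rwa [hM]⟩)).trans k.lt_succ_self
    · dsimp only
      have hlt : ∀ x ∈ S, x ≠ μ (f x) → c x < k := fun x hx h =>
        hc x (mem_sdiff.2 ⟨hx, by rwa [hM]⟩)
      split_ifs with h h' h'
      · exfalso
        rcases hfg with e | e
        · exact hij (by rw [h, h', e])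
        · rw [h, h', hμg, hμg] at e
          exact hij (by rw [h, h', hφ e])
      · exact (hlt j hj h').ne'
      · exact (hlt i hi h).ne
      · exact hcc i (mem_sdiff.2 ⟨hi, by rwa [hM]⟩) j (mem_sdiff.2 ⟨hj, by rwa [hM]⟩) hij hfg

open Finset in
/-- **König's edge colouring theorem** for bipartite multigraphs with edge set `I`. -/
theorem exists_edgeColoring_of_card_fiber_le {I T : Type*} [Fintype I] [Fintype T] [DecidableEq T]
    (f g : I → T) (k : ℕ) (hf : ∀ t, #{i | f i = t} ≤ k) (hg : ∀ t, #{i | g i = t} ≤ k) :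
    ∃ c : I → ℕ, (∀ i, c i < k) ∧ ∀ i j, i ≠ j → (f i = f j ∨ g i = g j) → c i ≠ c j := by
  classical
  have hcard : ∀ h : I → T, (∀ t, #{i | h i = t} ≤ k) →
      Fintype.card (Σ t, Fin (k - #{i | h i = t})) + Fintype.card I = Fintype.card T * k := by
    intro h hh
    rw [Fintype.card_sigma, ← card_univ (α := I),
      card_eq_sum_card_fiberwise (f := h) (t := univ) (fun i _ => mem_coe.2 (mem_univ _)),
      ← sum_add_distrib, ← card_univ, ← smul_eq_mul, ← sum_const]
    refine sum_congr rfl fun t _ => ?_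
    rw [Fintype.card_fin]
    exact Nat.sub_add_cancel (hh t)
  -- Padding to a regular multigraph: both sides lack `#T * k - #I` edge ends in total, so any
  -- bijection between the free slots supplies dummy edges.
  have e : (Σ t, Fin (k - #{i | f i = t})) ≃ (Σ t, Fin (k - #{i | g i = t})) :=
    Fintype.equivOfCardEq (by have := hcard f hf; have := hcard g hg; omega)
  have hslot : ∀ (h : I → T) (t : T),
      #{x : (Σ t, Fin (k - #{i | h i = t})) | x.1 = t} = k - #{i | h i = t} := by
    intro h t
    have : ({x : (Σ t, Fin (k - #{i | h i = t})) | x.1 = t} : Finset _) =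
        univ.map ⟨Sigma.mk t, sigma_mk_injective⟩ := by
      ext ⟨a, b⟩
      simp only [mem_filter, mem_univ, true_and, mem_map, Function.Embedding.coeFn_mk]
      constructor
      · rintro rfl
        exact ⟨b, rfl⟩
      · rintro ⟨b', hb'⟩
        exact (congrArg Sigma.fst hb').symm
    rw [this, card_map, card_univ, Fintype.card_fin]
  have hfib : ∀ (h : I → T) (p : (Σ t, Fin (k - #{i | f i = t})) → T) (t : T),
      #{i | h i = t} ≤ k → #{x | p x = t} = k - #{i | h i = t} →
      #{x | Sum.elim h p x = t} = k := by
    intro h p t hh hp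
    have : ({x | Sum.elim h p x = t} : Finset _) =
        ({i | h i = t} : Finset I).disjSum {x | p x = t} := by
      ext (x | x) <;> simp
    rw [this, card_disjSum, hp]
    omega
  obtain ⟨c, hc, hcc⟩ := exists_edgeColoring_of_regular (Sum.elim f Sigma.fst)
    (Sum.elim g fun x => (e x).1) k univ (fun t => hfib _ _ t (hf t) (hslot f t))
    (fun t => hfib _ _ t (hg t) (by
      rw [← hslot g t]
      exact card_equiv e (by simp)))
  exact ⟨fun i => c (Sum.inl i), fun i => hc _ (mem_univ _), fun i j hij h =>
    hcc _ (mem_univ _) _ (mem_univ _) (Sum.inl_injective.ne hij) h⟩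

namespace SimpleGraph

/-! ### Colouring the half-edges -/

open Finset in
/-- The half-edges of a graph with maximum degree at least `2` can be coloured with `Δ` colours so
that the half-edges at a vertex, and the two halves of an edge, get different colours. -/
theorem exists_dart_coloring {V : Type*} [Fintype V] (G : SimpleGraph V) [DecidableRel G.Adj]
    (hΔ : 2 ≤ G.maxDegree) : ∃ c : G.Dart → ℕ, (∀ d, c d < G.maxDegree) ∧
      (∀ d, c d ≠ c d.symm) ∧ ∀ d d' : G.Dart, d.fst = d'.fst → d ≠ d' → c d ≠ c d' := by
  classical
  -- Both sides of the bipartite graph must share one vertex type, hence the sum; the summand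
  -- foreign to a side only contributes empty fibres.
  obtain ⟨c, hc, hcc⟩ := exists_edgeColoring_of_card_fiber_le
    (fun d : G.Dart => (Sum.inl d.fst : V ⊕ Sym2 V)) (fun d => Sum.inr d.edge) G.maxDegree
    (by
      rintro (v | e)
      · simp only [Sum.inl.injEq]
        rw [G.dart_fst_fiber_card_eq_degree v]
        exact G.degree_le_maxDegree v
      · simp)
    (by
      rintro (v | e)
      · simp
      · simp only [Sum.inr.injEq]
        by_cases he : e ∈ G.edgeSet
        · rw [G.dart_edge_fiber_card e he]
          exact hΔ
        · rw [filter_eq_empty_iff.2]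
          · simp
          · rintro d _ rfl
            exact he d.edge_mem)
  refine ⟨c, hc, fun d => hcc _ _ d.symm_ne.symm (.inr ?_), fun d d' h hd => hcc _ _ hd (.inl ?_)⟩
  · rw [d.edge_symm]
  · rw [h]

/-! ### Coordinates along darts and short walks in the subdivision -/

variable {V : Type*} {G : SimpleGraph V} {n : ℕ}

/-- The dart of `G` along which `hyperedge G n e` runs. -/
noncomputable def outDart (e : G.edgeSet) : G.Dart :=
  ⟨Quot.out e.1, by
    have he : s((Quot.out e.1).1, (Quot.out e.1).2) = e.1 := Quot.out_eq e.1
    rw [← G.mem_edgeSet, he]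
    exact e.2⟩

theorem edge_outDart (e : G.edgeSet) : (outDart e).edge = e.1 := Quot.out_eq e.1

open Classical in
/-- The vertex of the `n`-subdivision at distance `l` from the start of the dart `d`, along `d`. -/
noncomputable def dartPoint (n : ℕ) (d : G.Dart) (l : ℕ) : G.SubdivVertex n :=
  if d = outDart ⟨d.edge, d.edge_mem⟩ then G.hyperedge n ⟨d.edge, d.edge_mem⟩ l
  else G.hyperedge n ⟨d.edge, d.edge_mem⟩ (n - l)

theorem dartPoint_outDart (e : G.edgeSet) (l : ℕ) :
    dartPoint n (outDart e) l = G.hyperedge n e l := by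
  have : (⟨(outDart e).edge, (outDart e).edge_mem⟩ : G.edgeSet) = e := Subtype.ext (edge_outDart e)
  rw [dartPoint, this, if_pos rfl]

theorem dartPoint_outDart_symm (e : G.edgeSet) (l : ℕ) :
    dartPoint n (outDart e).symm l = G.hyperedge n e (n - l) := by
  have : (⟨(outDart e).symm.edge, (outDart e).symm.edge_mem⟩ : G.edgeSet) = e :=
    Subtype.ext ((outDart e).edge_symm.trans (edge_outDart e))
  rw [dartPoint, this, if_neg (outDart e).symm_ne]

theorem exists_eq_outDart (d : G.Dart) :
    ∃ e : G.edgeSet, d = outDart e ∨ d = (outDart e).symm :=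
  ⟨⟨d.edge, d.edge_mem⟩, (dart_edge_eq_iff _ _).1 (edge_outDart ⟨d.edge, d.edge_mem⟩).symm⟩

theorem dartPoint_symm (d : G.Dart) {l : ℕ} (hl : l ≤ n) :
    dartPoint n d.symm l = dartPoint n d (n - l) := by
  obtain ⟨e, rfl | rfl⟩ := exists_eq_outDart d
  · rw [dartPoint_outDart_symm, dartPoint_outDart]
  · rw [Dart.symm_symm, dartPoint_outDart, dartPoint_outDart_symm, Nat.sub_sub_self hl]

theorem dartPoint_zero (hn : 0 < n) (d : G.Dart) : dartPoint n d 0 = Sum.inl d.fst := by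
  obtain ⟨e, rfl | rfl⟩ := exists_eq_outDart d
  · rw [dartPoint_outDart]
    simp [hyperedge, outDart]
  · rw [dartPoint_outDart_symm]
    simp [hyperedge, outDart, hn.ne']

theorem dartPoint_top (hn : 0 < n) (d : G.Dart) : dartPoint n d n = Sum.inl d.snd := by
  have := dartPoint_symm d (Nat.zero_le n)
  rw [Nat.sub_zero] at this
  rw [← this, dartPoint_zero hn]
  rfl

theorem dartPoint_eq_inr (d : G.Dart) {l : ℕ} (h0 : 0 < l) (hn : l < n) :
    ∃ e : G.edgeSet, (d = outDart e ∧ dartPoint n d l = Sum.inr (e, ⟨l, h0, hn⟩)) ∨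
      (d = (outDart e).symm ∧
        dartPoint n d l = Sum.inr (e, ⟨n - l, Nat.sub_pos_of_lt hn, by omega⟩)) := by
  obtain ⟨e, rfl | rfl⟩ := exists_eq_outDart d
  · refine ⟨e, .inl ⟨rfl, ?_⟩⟩
    rw [dartPoint_outDart, hyperedge, dif_pos ⟨h0, hn⟩]
  · refine ⟨e, .inr ⟨rfl, ?_⟩⟩
    rw [dartPoint_outDart_symm, hyperedge, dif_pos ⟨Nat.sub_pos_of_lt hn, by omega⟩]

theorem dartPoint_eq_dartPoint {d d' : G.Dart} {l l' : ℕ} (h0 : 0 < l) (hl : l < n)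
    (hl' : l' ≤ n) (h : dartPoint n d l = dartPoint n d' l') :
    (d' = d ∧ l' = l) ∨ (d' = d.symm ∧ l' = n - l) := by
  have hn : 0 < n := by omega
  obtain ⟨e, he⟩ := dartPoint_eq_inr d h0 hl
  have h1 : 0 < l' := by
    by_contra! h1
    obtain rfl : l' = 0 := by omega
    rw [dartPoint_zero hn] at h
    rcases he with he | he <;> · rw [h] at he; cases he.2
  have h2 : l' < n := by
    by_contra! h2
    obtain rfl : l' = n := by omega
    rw [dartPoint_top hn] at h
    rcases he with he | he <;> · rw [h] at he; cases he.2
  obtain ⟨e', he'⟩ := dartPoint_eq_inr d' h1 h2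
  rcases he with ⟨rfl, he⟩ | ⟨rfl, he⟩ <;> rcases he' with ⟨rfl, he'⟩ | ⟨rfl, he'⟩ <;>
    rw [he, he', Sum.inr.injEq, Prod.mk.injEq] at h <;>
    obtain ⟨rfl, h⟩ := h <;> have h := congrArg Subtype.val h <;> dsimp only at h
  · exact .inl ⟨rfl, h.symm⟩
  · exact .inr ⟨rfl, by omega⟩
  · exact .inr ⟨(Dart.symm_symm _).symm, by omega⟩
  · exact .inl ⟨rfl, by omega⟩

theorem dartPoint_eq_inl {d : G.Dart} {l : ℕ} {v : V} (hl : l ≤ n) (hn : 0 < n)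
    (h : dartPoint n d l = Sum.inl v) : (l = 0 ∧ d.fst = v) ∨ (l = n ∧ d.snd = v) := by
  rcases Nat.eq_zero_or_pos l with rfl | h0
  · rw [dartPoint_zero hn] at h
    exact .inl ⟨rfl, Sum.inl_injective h⟩
  rcases hl.eq_or_lt with rfl | hl
  · rw [dartPoint_top hn] at h
    exact .inr ⟨rfl, Sum.inl_injective h⟩
  obtain ⟨e, he | he⟩ := dartPoint_eq_inr d h0 hl <;> · rw [h] at he; cases he.2

theorem subdivision_adj_iff {x y : G.SubdivVertex n} : (G.subdivision n).Adj x y ↔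
    ∃ (d : G.Dart) (l : ℕ), l < n ∧ x = dartPoint n d l ∧ y = dartPoint n d (l + 1) := by
  constructor
  · rintro ⟨e, l, hl, ⟨rfl, rfl⟩ | ⟨rfl, rfl⟩⟩
    · exact ⟨outDart e, l, hl, by rw [dartPoint_outDart], by rw [dartPoint_outDart]⟩
    · refine ⟨(outDart e).symm, n - (l + 1), by omega, ?_, ?_⟩ <;> rw [dartPoint_outDart_symm] <;>
        congr 1 <;> omega
  · rintro ⟨d, l, hl, rfl, rfl⟩
    obtain ⟨e, rfl | rfl⟩ := exists_eq_outDart d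
    · exact ⟨e, l, hl, .inl ⟨dartPoint_outDart _ _, dartPoint_outDart _ _⟩⟩
    · refine ⟨e, n - (l + 1), by omega, .inr ⟨dartPoint_outDart_symm _ _, ?_⟩⟩
      rw [dartPoint_outDart_symm]
      congr 1
      omega

theorem adj_dartPoint {d : G.Dart} {l : ℕ} {y : G.SubdivVertex n} (h0 : 0 < l) (hl : l < n)
    (h : (G.subdivision n).Adj (dartPoint n d l) y) :
    y = dartPoint n d (l - 1) ∨ y = dartPoint n d (l + 1) := by
  obtain ⟨d', l', hl', hx, rfl⟩ := subdivision_adj_iff.1 h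
  rcases dartPoint_eq_dartPoint h0 hl hl'.le hx with ⟨rfl, rfl⟩ | ⟨rfl, rfl⟩
  · exact .inr rfl
  · left
    rw [dartPoint_symm _ (by omega)]
    congr 1
    omega

theorem adj_inl {v : V} {y : G.SubdivVertex n} (h : (G.subdivision n).Adj (Sum.inl v) y) :
    ∃ d : G.Dart, d.fst = v ∧ y = dartPoint n d 1 := by
  obtain ⟨d, l, hl, hx, rfl⟩ := subdivision_adj_iff.1 h
  rcases dartPoint_eq_inl hl.le (by omega) hx.symm with ⟨rfl, hv⟩ | ⟨rfl, hv⟩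
  · exact ⟨d, hv, rfl⟩
  · omega

/-- Vertices of the subdivision joined by a walk of length less than `n` are equal, lie on the path
of a common edge, or lie on the paths of two edges that share an end. -/
theorem eq_or_dartPoint_of_walk {x y : G.SubdivVertex n} (p : (G.subdivision n).Walk x y)
    (hp : p.length < n) : x = y ∨
    (∃ (d : G.Dart) (l l' : ℕ), l < l' ∧ l' ≤ n ∧ l' ≤ l + p.length ∧ x = dartPoint n d l ∧
      y = dartPoint n d l') ∨
    ∃ (d d' : G.Dart) (i j : ℕ), d.fst = d'.fst ∧ d ≠ d' ∧ 0 < i ∧ 0 < j ∧ i + j ≤ p.length ∧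
      x = dartPoint n d i ∧ y = dartPoint n d' j := by
  have hn : 0 < n := by omega
  induction p with
  | nil => exact .inl rfl
  | @cons x z y hadj p ih =>
    rw [Walk.length_cons] at hp ⊢
    rcases ih (by omega) with rfl | ⟨d, l, l', hlt, hl', hlen, rfl, rfl⟩ |
      ⟨d, d', i, j, hdd, hne, hi, hj, hij, rfl, rfl⟩
    · obtain ⟨d, l, hl, rfl, rfl⟩ := subdivision_adj_iff.1 hadj
      exact .inr (.inl ⟨d, l, l + 1, by omega, by omega, by omega, rfl, rfl⟩)
    -- At a terminal vertex the extra step may enter any incident edge; entering one other than `d`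
    -- produces the third alternative.
    · rcases Nat.eq_zero_or_pos l with rfl | h0
      · have hadj' := hadj.symm
        rw [dartPoint_zero hn] at hadj'
        obtain ⟨d', hd', rfl⟩ := adj_inl hadj'
        by_cases hdd : d' = d
        · subst hdd
          rcases (Nat.succ_le_iff.2 hlt).eq_or_lt with h | h
          · exact .inl (by rw [← h])
          · exact .inr (.inl ⟨d', 1, l', h, hl', by omega, rfl, rfl⟩)
        · exact .inr (.inr ⟨d', d, 1, l', hd', hdd, one_pos, hlt, by omega, rfl, rfl⟩)
      · rcases adj_dartPoint h0 (by omega) hadj.symm with rfl | rfl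
        · exact .inr (.inl ⟨d, l - 1, l', by omega, hl', by omega, rfl, rfl⟩)
        · rcases (Nat.succ_le_iff.2 hlt).eq_or_lt with h | h
          · exact .inl (by rw [← h])
          · exact .inr (.inl ⟨d, l + 1, l', h, hl', by omega, rfl, rfl⟩)
    -- Here `i < n` because `i + j` is below `n`: the walk is too short to reach the far end and
    -- branch a second time.
    · rcases adj_dartPoint hi (by omega) hadj.symm with rfl | rfl
      · rcases Nat.eq_zero_or_pos (i - 1) with h | h
        · refine .inr (.inl ⟨d', 0, j, hj, by omega, by omega, ?_, rfl⟩)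
          rw [h, dartPoint_zero hn, dartPoint_zero hn, hdd]
        · exact .inr (.inr ⟨d, d', i - 1, j, hdd, hne, h, hj, by omega, rfl, rfl⟩)
      · exact .inr (.inr ⟨d, d', i + 1, j, hdd, hne, by omega, hj, by omega, rfl, rfl⟩)

theorem edist_inl_dartPoint_le (d : G.Dart) {l : ℕ} (hl : l ≤ n) (hn : 0 < n) :
    (G.subdivision n).edist (Sum.inl d.fst) (dartPoint n d l) ≤ l := by
  induction l with
  | zero => rw [dartPoint_zero hn, edist_self]; exact zero_le
  | succ l ih =>
    refine (G.subdivision n).edist_triangle (v := dartPoint n d l) |>.trans ?_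
    push_cast
    refine add_le_add (ih (by omega)) ?_
    exact (edist_eq_one_iff_adj.2 (subdivision_adj_iff.2 ⟨d, l, by omega, rfl, rfl⟩)).le

theorem edist_dartPoint_le {d d' : G.Dart} (h : d.fst = d'.fst) {i j : ℕ} (hi : i ≤ n)
    (hj : j ≤ n) (hn : 0 < n) :
    (G.subdivision n).edist (dartPoint n d i) (dartPoint n d' j) ≤ (i + j : ℕ) := by
  refine (G.subdivision n).edist_triangle (v := Sum.inl d.fst) |>.trans ?_
  push_cast
  refine add_le_add ?_ ?_
  · rw [edist_comm]
    exact edist_inl_dartPoint_le d hi hn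
  · rw [h]
    exact edist_inl_dartPoint_le _ hj hn

/-! ### The periodic colouring and its palette -/

/-- The colour, periodic in `l` with period `M`, of the vertex at distance `l` from the start of the
dart `d`, built from a colouring `c` of the half-edges. -/
def pointColor (c : G.Dart → ℕ) (M : ℕ) (d : G.Dart) (l : ℕ) : ℕ × ℕ :=
  if l % M = 0 ∨ 2 * (l % M) = M then (l % M, 0)
  else if 2 * (l % M) < M then (l % M, c d) else (M - l % M, c d.symm)

/-- Since `M ∣ n`, reversal sends a residue `r ≠ 0` to `M - r` and swaps `c d` with `c d.symm`. The
residues `0` and `M / 2` are fixed by this, which is why their colour must not depend on the dart.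
-/
theorem pointColor_symm (c : G.Dart → ℕ) {M : ℕ} (hM : 0 < M) (hn : M ∣ n) (d : G.Dart) {l : ℕ}
    (hl : l ≤ n) : pointColor c M d.symm (n - l) = pointColor c M d l := by
  have h1 : (n - l) % M = if l % M = 0 then 0 else M - l % M := by
    obtain ⟨k, rfl⟩ := hn
    have hlt := Nat.mod_lt l hM
    have hdiv := Nat.div_add_mod l M
    split_ifs with h
    · exact Nat.mod_eq_zero_of_dvd (Nat.dvd_sub (Dvd.intro k rfl) (Nat.dvd_of_mod_eq_zero h))
    · have hq : l / M < k := by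
        by_contra! hq
        have := Nat.mul_le_mul_left M hq
        omega
      obtain ⟨j, hj⟩ := Nat.exists_eq_add_of_lt hq
      have : M * k = M * (l / M) + M * j + M := by
        conv_lhs => rw [hj]
        ring
      have : M * k - l = M - l % M + M * j := by omega
      rw [this, Nat.add_mul_mod_self_left, Nat.mod_eq_of_lt (by omega)]
  have hlt := Nat.mod_lt l hM
  unfold pointColor
  rw [h1, Dart.symm_symm]
  split_ifs <;> first | rfl | omega | (congr 1; omega)

/-- The residues differ, so first components can agree only for residues `r` and `M - r`. These lie
on opposite sides of `M / 2` and carry `c d` and `c d.symm`. -/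
theorem pointColor_ne_of_lt {c : G.Dart → ℕ} {M : ℕ} {d : G.Dart} (hc : c d ≠ c d.symm)
    {l l' : ℕ} (h : l < l') (h' : l' < l + M) : pointColor c M d l ≠ pointColor c M d l' := by
  have hM : 0 < M := by omega
  have hne : l % M ≠ l' % M := fun he => by
    have := Nat.le_of_dvd (by omega) ((Nat.modEq_iff_dvd' h.le).1 he)
    omega
  have h1 := Nat.mod_lt l hM
  have h2 := Nat.mod_lt l' hM
  unfold pointColor
  split_ifs <;> simp only [ne_eq, Prod.mk.injEq] <;> omega

/-- As `i + j < M` rules out `j = M - i`, equal first components force `i = j < M / 2`, where the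
second components are `c d` and `c d'`. -/
theorem pointColor_ne_of_fst_eq {c : G.Dart → ℕ} {M : ℕ} {d d' : G.Dart} (hc : c d ≠ c d')
    {i j : ℕ} (hi : 0 < i) (hj : 0 < j) (hij : i + j < M) :
    pointColor c M d i ≠ pointColor c M d' j := by
  unfold pointColor
  rw [Nat.mod_eq_of_lt (a := i) (by omega), Nat.mod_eq_of_lt (a := j) (by omega)]
  split_ifs <;> simp only [ne_eq, Prod.mk.injEq] <;> omega

/-- The colouring of the subdivision built from a colouring `c` of the half-edges. -/
noncomputable def subdivColor (c : G.Dart → ℕ) (M : ℕ) : G.SubdivVertex n → ℕ × ℕ :=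
  Sum.elim (fun _ => (0, 0)) fun p => pointColor c M (outDart p.1) p.2

/-- Independence of the orientation chosen by `outDart`. At the far end, `M ∣ n` makes the periodic
pattern return to the terminal colour `(0, 0)`. -/
theorem subdivColor_dartPoint (c : G.Dart → ℕ) {M : ℕ} (hM : 0 < M) (hn : M ∣ n) (hn0 : 0 < n)
    (d : G.Dart) {l : ℕ} (hl : l ≤ n) :
    subdivColor c M (dartPoint n d l) = pointColor c M d l := by
  rcases Nat.eq_zero_or_pos l with rfl | h0
  · simp [dartPoint_zero hn0, subdivColor, pointColor]
  rcases hl.eq_or_lt with rfl | hlt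
  · simp [dartPoint_top hn0, subdivColor, pointColor, Nat.mod_eq_zero_of_dvd hn]
  obtain ⟨e, ⟨rfl, he⟩ | ⟨rfl, he⟩⟩ := dartPoint_eq_inr d h0 hlt
  · rw [he]
    rfl
  · rw [he, ← pointColor_symm c hM hn _ hl, Dart.symm_symm]
    rfl

theorem subdivColor_ne {c : G.Dart → ℕ} {m : ℕ} (hc : ∀ d, c d ≠ c d.symm)
    (hcc : ∀ d d' : G.Dart, d.fst = d'.fst → d ≠ d' → c d ≠ c d') (hn : m + 1 ∣ n) (hn0 : 0 < n)
    {x y : G.SubdivVertex n} (h : (G.fractionalPower m n).Adj x y) :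
    subdivColor c (m + 1) x ≠ subdivColor c (m + 1) y := by
  obtain ⟨hxy, hd⟩ := h
  have hmn := Nat.le_of_dvd hn0 hn
  obtain ⟨p, hp⟩ := exists_walk_of_edist_ne_top (ne_top_of_le_ne_top (ENat.natCast_ne_top m) hd)
  rw [← hp, Nat.cast_le] at hd
  rcases eq_or_dartPoint_of_walk p (by omega) with rfl | ⟨d, l, l', hlt, hl', hlen, rfl, rfl⟩ |
      ⟨d, d', i, j, hdd, hne, hi, hj, hij, rfl, rfl⟩
  · exact absurd rfl hxy
  · rw [subdivColor_dartPoint c m.succ_pos hn hn0 d (by omega),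
      subdivColor_dartPoint c m.succ_pos hn hn0 d hl']
    exact pointColor_ne_of_lt (hc d) hlt (by omega)
  · rw [subdivColor_dartPoint c m.succ_pos hn hn0 d (by omega),
      subdivColor_dartPoint c m.succ_pos hn hn0 d' (by omega)]
    exact pointColor_ne_of_fst_eq (hcc d d' hdd hne) hi hj (by omega)

-- The image over `range (m % 2)` is an indicator: the midpoint colour `(m / 2 + 1, 0)` is present
-- only for odd `m`, when `m + 1` is even.
open Finset in
theorem subdivColor_mem {c : G.Dart → ℕ} {m D : ℕ} (hc : ∀ d, c d < D) (x : G.SubdivVertex n) :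
    subdivColor c (m + 1) x ∈ insert (0, 0) (Icc 1 (m / 2) ×ˢ range D) ∪
      (range (m % 2)).image fun _ => (m / 2 + 1, 0) := by
  have hp : ∀ d l, pointColor c (m + 1) d l ∈ insert (0, 0) (Icc 1 (m / 2) ×ˢ range D) ∪
      (range (m % 2)).image fun _ => (m / 2 + 1, 0) := by
    intro d l
    have hlt : l % (m + 1) < m + 1 := Nat.mod_lt l m.succ_pos
    have h1 := hc d
    have h2 := hc d.symm
    unfold pointColor
    split_ifs with h h' <;>
      simp only [mem_union, mem_insert, mem_product, mem_Icc, mem_range, mem_image, Prod.mk.injEq]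
    · rcases h with h | h
      · exact .inl (.inl ⟨h, trivial⟩)
      · exact .inr ⟨0, by omega, by omega, trivial⟩
    · exact .inl (.inr ⟨by omega, h1⟩)
    · exact .inl (.inr ⟨by omega, h2⟩)
  rcases x with v | p
  · exact mem_union_left _ (mem_insert_self _ _)
  · exact hp _ _

/-- If `m + 1` divides `n`, the half-edge colouring extends to a colouring of `G^(m/n)`. -/
theorem colorable_fractionalPower [Fintype V] [DecidableRel G.Adj] (hΔ : 2 ≤ G.maxDegree) {m : ℕ}
    (hn : m + 1 ∣ n) (hn0 : 0 < n) :
    (G.fractionalPower m n).Colorable (m / 2 * G.maxDegree + 1 + m % 2) := by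
  obtain ⟨c, hc, hc1, hc2⟩ := G.exists_dart_coloring hΔ
  refine (Coloring.mk (fun x => (⟨subdivColor c (m + 1) x, subdivColor_mem hc x⟩ :
    {p // p ∈ _})) fun {x y} h => ?_).colorable.mono ?_
  · exact fun he => subdivColor_ne hc1 hc2 hn hn0 h (congrArg Subtype.val he)
  · rw [Fintype.card_coe]
    refine (Finset.card_union_le _ _).trans (add_le_add ((Finset.card_insert_le _ _).trans ?_)
      (Finset.card_image_le.trans ?_))
    · rw [Finset.card_product, Nat.card_Icc, Finset.card_range, Nat.add_sub_cancel]
    · rw [Finset.card_range]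

/-! ### A clique of matching size -/

open Finset in
/-- The ball of radius `m / 2` around a vertex of maximum degree, with one more vertex if `m` is
odd, is a clique of `G^(m/n)`. -/
theorem le_cliqueNum_fractionalPower [Fintype V] [DecidableRel G.Adj] (hΔ : 2 ≤ G.maxDegree)
    {m : ℕ} (hm : 0 < m) (hn : m + 1 ∣ n) (hn0 : 0 < n) :
    m / 2 * G.maxDegree + 1 + m % 2 ≤ (G.fractionalPower m n).cliqueNum := by
  classical
  have hmn := Nat.le_of_dvd hn0 hn
  obtain ⟨c, hc, hc1, hc2⟩ := G.exists_dart_coloring hΔ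
  have : Nonempty V := by
    by_contra h
    rw [not_nonempty_iff] at h
    rw [G.maxDegree_of_subsingleton] at hΔ
    omega
  obtain ⟨v, hv⟩ := G.exists_maximal_degree_vertex
  have hcard : #{d : G.Dart | d.fst = v} = G.maxDegree :=
    (G.dart_fst_fiber_card_eq_degree v).trans hv.symm
  obtain ⟨d₀, hd₀⟩ : ({d : G.Dart | d.fst = v} : Finset _).Nonempty := by
    rw [← card_pos]
    omega
  replace hd₀ : d₀.fst = v := by simpa using hd₀
  -- Clique vertices as pairs (dart, distance from `v`). The centre is recorded once, through `d₀`,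
  -- and the last block holds the extra vertex for odd `m`.
  set K : Finset (G.Dart × ℕ) := insert (d₀, 0)
    (({d : G.Dart | d.fst = v} : Finset _) ×ˢ Icc 1 (m / 2)) ∪
    {d₀} ×ˢ (range (m % 2)).image fun _ => m / 2 + 1 with hK
  have hKcard : #K = m / 2 * G.maxDegree + 1 + m % 2 := by
    rw [hK, card_union_of_disjoint, card_insert_of_notMem, card_product, card_product, hcard,
      Nat.card_Icc, card_singleton, one_mul, Nat.add_sub_cancel, mul_comm]
    · congr 1
      rcases Nat.mod_two_eq_zero_or_one m with h | h <;> rw [h] <;> simp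
    · simp
    · rw [Finset.disjoint_left]
      rintro ⟨d, i⟩ h h'
      simp only [mem_insert, mem_product, mem_Icc, mem_image, mem_range, Prod.mk.injEq] at h h'
      obtain ⟨-, a, -, ha⟩ := h'
      omega
  have hmem : ∀ p ∈ K, p.1.fst = v ∧
      ((p.1 = d₀ ∧ (p.2 = 0 ∨ 2 * p.2 = m + 1)) ∨ 0 < p.2 ∧ 2 * p.2 ≤ m) := by
    rintro ⟨d, i⟩ h
    simp only [hK, mem_union, mem_insert, mem_product, mem_Icc, mem_image, mem_range,
      mem_singleton, Prod.mk.injEq, mem_filter, mem_univ, true_and] at h ⊢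
    rcases h with (⟨rfl, rfl⟩ | ⟨h, h'⟩) | ⟨rfl, a, ha, h'⟩
    · exact ⟨hd₀, .inl ⟨rfl, .inl rfl⟩⟩
    · exact ⟨h, .inr (by omega)⟩
    · exact ⟨hd₀, .inl ⟨rfl, .inr (by omega)⟩⟩
  have hpair : ∀ p ∈ K, ∀ q ∈ K, p ≠ q →
      (G.fractionalPower m n).Adj (dartPoint n p.1 p.2) (dartPoint n q.1 q.2) := by
    rintro ⟨d, i⟩ hp ⟨d', j⟩ hq hne
    obtain ⟨hdv, h⟩ := hmem _ hp
    obtain ⟨hdv', h'⟩ := hmem _ hq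
    dsimp only at hdv hdv' h h' ⊢
    -- Only the extra vertex is farther than `m / 2` from `v`, at distance `(m + 1) / 2`, and two
    -- distinct pairs cannot both be it.
    have hij : i + j ≤ m := by
      rcases h with ⟨rfl, h⟩ | h <;> rcases h' with ⟨rfl, h'⟩ | h' <;> try omega
      by_contra hlt
      exact hne (congrArg (Prod.mk _) (by omega))
    refine ⟨fun he => hne ?_, (edist_dartPoint_le (hdv.trans hdv'.symm) (by omega) (by omega)
      hn0).trans (Nat.cast_le.2 hij)⟩
    -- The colouring also shows that distinct pairs give distinct vertices: up to distance `(m + 1)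
    -- / 2` from `v`, a colour determines the distance and, where it matters, the dart.
    replace he := congrArg (subdivColor c (m + 1)) he
    rw [subdivColor_dartPoint c m.succ_pos hn hn0 d (by omega),
      subdivColor_dartPoint c m.succ_pos hn hn0 d' (by omega), pointColor, pointColor,
      Nat.mod_eq_of_lt (a := i) (by omega), Nat.mod_eq_of_lt (a := j) (by omega)] at he
    have hdd : c d = c d' → d = d' := fun h =>
      by_contra fun hd => hc2 d d' (hdv.trans hdv'.symm) hd h
    split_ifs at he <;> obtain ⟨he₁, he₂⟩ := Prod.mk.inj he <;> try omega
    · exact Prod.ext ((h.resolve_right (by omega)).1.trans (h'.resolve_right (by omega)).1.symm) he₁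
    · exact Prod.ext (hdd he₂) he₁
  rw [← hKcard, ← card_image_of_injOn (s := K) (f := fun p => dartPoint n p.1 p.2)]
  · refine IsClique.card_le_cliqueNum (tc := ?_)
    intro x hx y hy hxy
    obtain ⟨p, hp, rfl⟩ := mem_image.1 (mem_coe.1 hx)
    obtain ⟨q, hq, rfl⟩ := mem_image.1 (mem_coe.1 hy)
    exact hpair p hp q hq fun h => hxy (by rw [h])
  · intro p hp q hq h
    by_contra hne
    exact (hpair p hp q hq hne).ne h

end SimpleGraph

theorem corollary2 {V : Type*} [Fintype V] (G : SimpleGraph V) [DecidableRel G.Adj]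
    (hG : G.Connected) (hΔ : 3 ≤ G.maxDegree) (k m : ℕ) (hk : 0 < k) (hm : 0 < m) :
    (G.fractionalPower m (k * (m + 1))).chromaticNumber =
      ((G.fractionalPower m (k * (m + 1))).cliqueNum : ℕ∞) := by
  have hn : m + 1 ∣ k * (m + 1) := Dvd.intro_left k rfl
  have hn0 : 0 < k * (m + 1) := Nat.mul_pos hk m.succ_pos
  have hΔ' : 2 ≤ G.maxDegree := by omega
  refine le_antisymm ?_ SimpleGraph.cliqueNum_le_chromaticNumber
  exact (SimpleGraph.colorable_fractionalPower hΔ' hn hn0).chromaticNumber_le.trans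
    (Nat.cast_le.2 (SimpleGraph.le_cliqueNum_fractionalPower hΔ' hm hn hn0))
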